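/- Fix a universal (plain) computer $V$ and a universal prefix computer $U$ (programs are binary strings; $U$ may receive an additional input $y$, and for every fixed $y$ its set of halting programs is prefix-free; $U$ simulates every prefix computer with a bounded overhead in program length, the simulating program not depending on $y$). For $x\in\{0,1\}^*$ of length $\ell(x)$ let $C(x)=\min\{\ell(p): V(p)=x\}$ and $K(x)=\min\{\ell(p): U(p)=x\}$ (with empty additional input), and let $K(n)$, $n\in\mathbb N$, be $K$ of the binary expansion of $n$. For $r\in\mathbb N$, $x$ is called $r$-incompressible if $K(x)\ge \ell(x)+K(\ell(x))-r$. An ensemble $\mathbb E$ is a computable probability distribution on $\{0,1\}^*$ whose entropy $H(\mathbb E)=-\sum_s \mathbb E(s)\log_2\mathbb E(s)$ is finite and computable. $K(\mathbb E)$ is the length of a shortest program for $U$ that computes both $\mathbb E$ and $H(\mathbb E)$, i.e. that outputs $2^{-n}$-approximations of $\mathbb E(s)$ given $(s,n)$, and of $H(\mathbb E)$ given $n$ and a request for the entropy. For $\delta,\Delta\ge 0$ and a set $\mathcal C$ of ensembles put $$\mathcal E_{\delta,\Delta}(x\,|\,\mathcal C)=\inf\{K(\mathbb E)\;:\;\mathbb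 E\in\mathcal C,\ \mathbb E(x)\ge 2^{-H(\mathbb E)(1+\delta)},\ K(\mathbb E)+H(\mathbb E)\le K(x)+\Delta\}$$ ($\infty$ if the set is empty), and let $\mathcal E_{\delta,\Delta}(x)$ be this quantity for $\mathcal C$ the set of all ensembles. Let $\delta_x$ denote the Dirac measure at $x$. The set $\mathcal C$ is convex if it contains all finite convex combinations $\sum_i\lambda_i\mathbb E_i$ of its elements with computable weights $\lambda_i\in(0,1)$, $\sum_i\lambda_i=1$; it is decidable if some algorithm decides, given $x$, whether $\delta_x\in\mathcal C$, and then $K(\mathcal C)$ is the length of a shortest program $p$ such that, for every $x$, $U$ on program $p$ and additional input $x$ outputs this decision. Then there are constants $c,k\in\mathbb N$, depending only on $U$ and $V$, such that: 1. for all $r\in\mathbb N$, all $r$-incompressible strings $x$, all $\delta\ge 0$ and all $\Delta\ge r+c$, $$\mathcal E_{\delta,\Delta}(x)\le K(C(x))+r+k;$$ 2. for every convex and decidable set $\mathcal C$ of ensembles, all $r\in\mathbb N$, all $r$-incompressible strings $x$ with $\delta_x\in\mathcal C$, all $\delta\ge 0$ and all $\Delta\ge r+c+K(\mathcal C)$,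 $$\mathcal E_{\delta,\Delta}(x\,|\,\mathcal C)\le K(C(x))+r+K(\mathcal C)+k.$$ -/

import Mathlib

noncomputable section

namespace EffectiveComplexity

/-- Finite binary strings; `List.length` is the length `ℓ`. -/
abbrev BitString : Type := List Bool

/-- Finite objects (integers, pairs, ...) are written as binary strings: the binary expansion of
their code number. In particular `code (n : ℕ)` is the binary expansion of `n`. -/
def code {α : Type} [Primcodable α] (a : α) : BitString :=
  Computability.encodeNat (Encodable.encode a)

/-! ### Computers and Kolmogorov complexity -/

/-- A universal computer `V`: it is partial recursive, and it simulates every partial recursive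
`W` with a bounded overhead in program length. -/
def IsUniversalComputer (V : BitString →. BitString) : Prop :=
  Partrec V ∧
    ∀ W : BitString →. BitString, Partrec W →
      ∃ c : ℕ, ∀ p : BitString, ∃ q : BitString, q.length ≤ p.length + c ∧ V q = W p

/-- A prefix computer, with program `p` and side input `y`: for each side input, no halting program
is a proper prefix of another one. -/
def IsPrefixComputer (W : BitString → BitString →. BitString) : Prop :=
  Partrec₂ W ∧
    ∀ y p q : BitString, (W p y).Dom → (W q y).Dom → p <+: q → p = q

/-- A universal prefix computer: it simulates every prefix computer with a bounded overhead in
program length, the simulating program being independent of the side input. -/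
def IsUniversalPrefixComputer (U : BitString → BitString →. BitString) : Prop :=
  IsPrefixComputer U ∧
    ∀ W : BitString → BitString →. BitString, IsPrefixComputer W →
      ∃ c : ℕ, ∀ p : BitString, ∃ q : BitString,
        q.length ≤ p.length + c ∧ ∀ y : BitString, U q y = W p y

/-- Plain Kolmogorov complexity `C(x)`. (A minimum over a nonempty set if `V` is universal.) -/
def plainK (V : BitString →. BitString) (x : BitString) : ℕ :=
  sInf {l : ℕ | ∃ p : BitString, p.length = l ∧ x ∈ V p}

/-- Prefix Kolmogorov complexity `K(x)` of a string. (A minimum over a nonempty set if `U` is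
universal.) -/
def prefixK (U : BitString → BitString →. BitString) (x : BitString) : ℕ :=
  sInf {l : ℕ | ∃ p : BitString, p.length = l ∧ x ∈ U p []}

/-- Prefix Kolmogorov complexity `K(n)` of an integer. -/
def prefixKNat (U : BitString → BitString →. BitString) (n : ℕ) : ℕ :=
  prefixK U (code n)

/-- `x` is `r`-incompressible: `K(x) ≥ ℓ(x) + K(ℓ(x)) - r`. -/
def IsIncompressible (U : BitString → BitString →. BitString) (r : ℕ) (x : BitString) : Prop :=
  x.length + prefixKNat U x.length ≤ prefixK U x + r

/-! ### Ensembles -/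

/-- `m / 2 ^ n` approximates the real number `a` with accuracy `2 ^ (-n)`. -/
def Approximates (m n : ℕ) (a : ℝ) : Prop :=
  |a - (m : ℝ) / 2 ^ n| ≤ 1 / 2 ^ n

/-- Computability of a nonnegative real number. -/
def IsComputableNonneg (a : ℝ) : Prop :=
  ∃ g : ℕ → ℕ, Computable g ∧ ∀ n : ℕ, Approximates (g n) n a

/-- The summands of the entropy (base `2`) of a probability distribution. -/
def entropyTerm (P : PMF BitString) (s : BitString) : ℝ :=
  -((P s).toReal * Real.logb 2 (P s).toReal)

/-- The entropy (base `2`) of a probability distribution. -/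
def entropyOf (P : PMF BitString) : ℝ :=
  ∑' s : BitString, entropyTerm P s

/-- Ensembles: the computable probability distributions on the binary strings whose entropy is
finite and computable. -/
structure Ensemble where
  dist : PMF BitString
  computable_dist : ∃ f : BitString → ℕ → ℕ, Computable₂ f ∧
    ∀ (s : BitString) (n : ℕ), Approximates (f s n) n (dist s).toReal
  finite_entropy : Summable (entropyTerm dist)
  computable_entropy : IsComputableNonneg (entropyOf dist)

/-- The probability `𝔼(s)`. -/
def Ensemble.prob (E : Ensemble) (s : BitString) : ℝ := (E.dist s).toReal

/-- The entropy `H(𝔼)`. -/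
def Ensemble.entropy (E : Ensemble) : ℝ := entropyOf E.dist

theorem entropyTerm_pure (x : BitString) : entropyTerm (PMF.pure x) = fun _ => 0 := by
  funext s
  by_cases h : s = x <;> simp [entropyTerm, PMF.pure_apply, h]

/-- The Dirac measure `δ_x`. -/
def dirac (x : BitString) : Ensemble where
  dist := PMF.pure x
  computable_dist := by
    have h2 : Primrec fun n : ℕ => 2 ^ n :=
      (Primrec.nat_rec₁ (f := fun _ m => 2 * m) 1
        (Primrec.nat_mul.comp (Primrec.const 2) Primrec.snd)).of_eq fun n => by
          induction n with
          | zero => rfl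
          | succ k ih => simp only [pow_succ]; omega
    refine ⟨fun s n => if s = x then 2 ^ n else 0, ?_, ?_⟩
    · exact (Primrec.ite (Primrec.eq.comp Primrec.fst (Primrec.const x))
        (h2.comp Primrec.snd) (Primrec.const 0)).to_comp
    · intro s n
      by_cases h : s = x <;> simp [Approximates, PMF.pure_apply, h]
  finite_entropy := by
    rw [entropyTerm_pure]
    exact summable_zero
  computable_entropy := by
    refine ⟨fun _ => 0, Computable.const 0, fun n => ?_⟩
    simp [Approximates, entropyOf, entropyTerm_pure]

/-- The program `p` computes the ensemble `E` together with its entropy: given a string `s` and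
an accuracy `n`, it outputs a `2 ^ (-n)`-approximation of `E(s)`; its subprogram for the entropy
(called by `none` in place of a string) outputs, given `n`, a `2 ^ (-n)`-approximation of `H(E)`. -/
def ComputesEnsemble (U : BitString → BitString →. BitString) (p : BitString) (E : Ensemble) :
    Prop :=
  (∀ (s : BitString) (n : ℕ), ∃ m : ℕ,
    code m ∈ U p (code ((some s, n) : Option BitString × ℕ)) ∧ Approximates m n (E.prob s)) ∧
  (∀ n : ℕ, ∃ m : ℕ,
    code m ∈ U p (code ((none, n) : Option BitString × ℕ)) ∧ Approximates m n E.entropy)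

/-- The complexity `K(𝔼)` (that is, `K(𝔼, H(𝔼))`) of an ensemble. (A minimum over a nonempty set
if `U` is universal.) -/
def ensembleK (U : BitString → BitString →. BitString) (E : Ensemble) : ℕ :=
  sInf {l : ℕ | ∃ p : BitString, p.length = l ∧ ComputesEnsemble U p E}

/-- Total information `Σ(𝔼) = K(𝔼) + H(𝔼)`. -/
def totalInformation (U : BitString → BitString →. BitString) (E : Ensemble) : ℝ :=
  (ensembleK U E : ℝ) + E.entropy

/-- `x` is `δ`-typical for `E`. -/
def IsTypical (δ : ℝ) (x : BitString) (E : Ensemble) : Prop :=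
  (2 : ℝ) ^ (-(E.entropy * (1 + δ))) ≤ E.prob x

/-- The minimization domain of `x`. -/
def minDomain (U : BitString → BitString →. BitString) (δ Δ : ℝ) (x : BitString) :
    Set Ensemble :=
  {E | IsTypical δ x E ∧ totalInformation U E ≤ (prefixK U x : ℝ) + Δ}

/-- Effective complexity of `x`; it is `⊤` if the minimization domain is empty. -/
def effComplexity (U : BitString → BitString →. BitString) (δ Δ : ℝ) (x : BitString) : ℕ∞ :=
  ⨅ E ∈ minDomain U δ Δ x, (ensembleK U E : ℕ∞)

/-- Effective complexity of `x` constrained to a set `𝒞` of ensembles; it is `⊤` if the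
constrained minimization domain is empty. -/
def effComplexityWithin (U : BitString → BitString →. BitString) (δ Δ : ℝ) (x : BitString)
    (𝒞 : Set Ensemble) : ℕ∞ :=
  ⨅ E ∈ minDomain U δ Δ x ∩ 𝒞, (ensembleK U E : ℕ∞)

/-! ### Constraints -/

/-- `𝒞` is convex: it contains all computable finite convex combinations of its elements. -/
def IsConvex (𝒞 : Set Ensemble) : Prop :=
  ∀ (k : ℕ) (E : Fin k → Ensemble) (w : Fin k → ℝ),
    (∀ i, E i ∈ 𝒞) → (∀ i, w i ∈ Set.Ioo (0 : ℝ) 1) → (∀ i, IsComputableNonneg (w i)) →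
    ∑ i, w i = 1 →
    ∀ F : Ensemble, (∀ s : BitString, F.prob s = ∑ i, w i * (E i).prob s) → F ∈ 𝒞

/-- `𝒞` is decidable: some algorithm decides on input `x` whether `δ_x ∈ 𝒞`. -/
def IsDecidable (𝒞 : Set Ensemble) : Prop :=
  ComputablePred fun x : BitString => dirac x ∈ 𝒞

/-- The program `p` computes the decision function `x ↦ [δ_x ∈ 𝒞]`. -/
def DecidesConstraint (U : BitString → BitString →. BitString) (p : BitString)
    (𝒞 : Set Ensemble) : Prop :=
  ∀ x : BitString,
    (dirac x ∈ 𝒞 → [true] ∈ U p x) ∧ (dirac x ∉ 𝒞 → [false] ∈ U p x)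

/-- The complexity `K(𝒞)` of a set of ensembles. (A minimum over a nonempty set if `U` is
universal and `𝒞` is decidable.) -/
def constraintK (U : BitString → BitString →. BitString) (𝒞 : Set Ensemble) : ℕ :=
  sInf {l : ℕ | ∃ p : BitString, p.length = l ∧ DecidesConstraint U p 𝒞}

end EffectiveComplexity

end

noncomputable section

namespace EffectiveComplexity

/-! ### Computability of the basic string operations -/

/-! Let `x` be `r`-incompressible of length `n`, and let `E` be the uniform distribution on the
strings `y` of length `n` with `δ_y ∈ 𝒞`. Convexity puts `E` in `𝒞`
(`IsConvex.uniformEnsemble_mem`). Since `E(x) = 2^(-H(E))`, `x` is typical for every `δ ≥ 0`, and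
`H(E) ≤ n`. A shortest program for `n` followed by a shortest decision program for `𝒞` determines
`E` and `H(E)`, so `K(E) ≤ K(n) + K(𝒞) + O(1)` (`exists_ensembleK_uniform_le`). Incompressibility
then bounds the total information: `K(E) + H(E) ≤ n + K(n) + K(𝒞) + O(1) ≤ K(x) + r + K(𝒞) + O(1)`.

It remains to replace `K(n)` by `K(C(x))` (`prefixKNat_length_le`). From `K(x) ≤ C(x) + K(C(x)) +
O(1)`, `C(x) ≤ n + O(1)` and `n + K(n) - r ≤ K(x)` the length `n` cancels, which leaves `K(n) ≤
K(C(x)) + r + O(1)`.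

The unconstrained claim is the case where `𝒞` is the set of all ensembles, whose complexity is a
constant. The machine-level ingredient is `exists_concat`: self-delimiting programs can be
concatenated. -/

theorem primrec₂_pow : Primrec₂ fun a b : ℕ => a ^ b := by
  have h : Primrec₂ fun (a b : ℕ) => Nat.rec (motive := fun _ => ℕ) 1 (fun _ m => a * m) b :=
    Primrec.nat_rec (f := fun _ : ℕ => 1) (g := fun a p => a * p.2) (Primrec.const 1)
      (Primrec.nat_mul.comp Primrec.fst (Primrec.snd.comp Primrec.snd)).to₂
  refine h.of_eq fun a b => ?_
  induction b with
  | zero => rfl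
  | succ k ih => rw [pow_succ, ← ih, mul_comm]

theorem primrec_log_two : Primrec (Nat.log 2) := by
  have h : Primrec fun m : ℕ => Nat.findGreatest (fun l => 2 ^ l ≤ m) m :=
    Primrec.nat_findGreatest Primrec.id
      (Primrec.nat_le.comp (primrec₂_pow.comp (Primrec.const 2) Primrec.snd) Primrec.fst)
  refine h.of_eq fun m => ?_
  rcases Nat.eq_zero_or_pos m with rfl | hm
  · rfl
  · rw [Nat.findGreatest_eq_iff]
    refine ⟨Nat.log_le_self 2 m, fun _ => Nat.pow_log_le_self 2 hm.ne', fun n hn _ => ?_⟩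
    exact not_le.2 (Nat.lt_pow_of_log_lt one_lt_two hn)

/-- Addition of `1` to a number in binary expansion, lowest digit first. -/
def binarySucc : BitString → BitString
  | [] => [true]
  | false :: l => true :: l
  | true :: l => false :: binarySucc l

theorem primrec_binarySucc : Primrec binarySucc := by
  have h : Primrec fun l : BitString => List.rec (motive := fun _ => BitString) [true]
      (fun b t ih => bif b then false :: ih else true :: t) l :=
    Primrec.list_rec (f := fun l : BitString => l) (g := fun _ => [true])
      (h := fun _ p => bif p.1 then false :: p.2.2 else true :: p.2.1)
      Primrec.id (Primrec.const _)
      (Primrec.cond (Primrec.fst.comp Primrec.snd)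
        (Primrec.list_cons.comp (Primrec.const false)
          (Primrec.snd.comp (Primrec.snd.comp Primrec.snd)))
        (Primrec.list_cons.comp (Primrec.const true)
          (Primrec.fst.comp (Primrec.snd.comp Primrec.snd)))).to₂
  refine h.of_eq fun l => ?_
  induction l with
  | nil => rfl
  | cons b t ih => cases b <;> simp [binarySucc, ih]

theorem encodePosNum_succ (p : PosNum) :
    Computability.encodePosNum p.succ = binarySucc (Computability.encodePosNum p) := by
  induction p with
  | one => rfl
  | bit1 p ih => simp [PosNum.succ, Computability.encodePosNum, binarySucc, ih]
  | bit0 p ih => simp [PosNum.succ, Computability.encodePosNum, binarySucc]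

/-- Turns binary expansion, defined through `Num`, into a recursion on `n`, from which primitive
recursiveness can be read off. -/
theorem encodeNat_succ (n : ℕ) :
    Computability.encodeNat (n + 1) = binarySucc (Computability.encodeNat n) := by
  unfold Computability.encodeNat
  rw [Nat.cast_succ, Num.add_one]
  cases (n : Num) with
  | zero => rfl
  | pos p => exact encodePosNum_succ p

theorem primrec_encodeNat : Primrec Computability.encodeNat := by
  have h : Primrec fun n : ℕ => Nat.rec (motive := fun _ => BitString) []
      (fun _ l => binarySucc l) n :=
    Primrec.nat_rec₁ (f := fun _ l => binarySucc l) []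
      (primrec_binarySucc.comp Primrec.snd).to₂
  refine h.of_eq fun n => ?_
  induction n with
  | zero => rfl
  | succ k ih => rw [encodeNat_succ, ← ih]

theorem primrec_code {α : Type} [Primcodable α] : Primrec (code : α → BitString) :=
  primrec_encodeNat.comp Primrec.encode

/-- The empty string decodes to `0` as a `Num` but to `1` as a `PosNum`; hence the recursion has to
treat an empty tail separately. -/
theorem decodeNat_cons (b : Bool) (l : BitString) :
    Computability.decodeNat (b :: l) = bif b then
      (if l.length = 0 then 1 else 2 * Computability.decodeNat l + 1)
      else (if l.length = 0 then 2 else 2 * Computability.decodeNat l) := by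
  unfold Computability.decodeNat Computability.decodeNum
  cases b <;> cases l <;>
    simp [Computability.decodePosNum, Num.cast_pos, PosNum.cast_bit0, PosNum.cast_bit1] <;> ring

theorem primrec_decodeNat : Primrec Computability.decodeNat := by
  have h : Primrec fun l : BitString => List.rec (motive := fun _ => ℕ) 0
      (fun b t ih => bif b then (if t.length = 0 then 1 else 2 * ih + 1)
        else (if t.length = 0 then 2 else 2 * ih)) l := by
    have ht : Primrec fun q : BitString × Bool × BitString × ℕ => q.2.2.1.length :=
      Primrec.list_length.comp (Primrec.fst.comp (Primrec.snd.comp Primrec.snd))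
    have hi : Primrec fun q : BitString × Bool × BitString × ℕ => 2 * q.2.2.2 :=
      Primrec.nat_mul.comp (Primrec.const 2) (Primrec.snd.comp (Primrec.snd.comp Primrec.snd))
    exact Primrec.list_rec (f := fun l : BitString => l) (g := fun _ => 0)
      (h := fun _ p => bif p.1 then (if p.2.1.length = 0 then 1 else 2 * p.2.2 + 1)
        else (if p.2.1.length = 0 then 2 else 2 * p.2.2))
      Primrec.id (Primrec.const _)
      (Primrec.cond (Primrec.fst.comp Primrec.snd)
        (Primrec.ite (Primrec.eq.comp ht (Primrec.const 0)) (Primrec.const 1)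
          (Primrec.succ.comp hi))
        (Primrec.ite (Primrec.eq.comp ht (Primrec.const 0)) (Primrec.const 2) hi)).to₂
  refine h.of_eq fun l => ?_
  induction l with
  | nil => rfl
  | cons b t ih => rw [decodeNat_cons, ← ih]

/-- The object with a given code. -/
def uncode (α : Type) [Primcodable α] (s : BitString) : Option α :=
  Encodable.decode (Computability.decodeNat s)

theorem primrec_uncode (α : Type) [Primcodable α] : Primrec (uncode α) :=
  Primrec.decode.comp primrec_decodeNat

@[simp]
theorem uncode_code {α : Type} [Primcodable α] (a : α) : uncode α (code a) = some a := by
  simp [uncode, code]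

/-- The list of all strings of a given length. -/
def stringsOfLength (n : ℕ) : List BitString :=
  Nat.rec [[]] (fun _ L => L.map (List.cons true) ++ L.map (List.cons false)) n

theorem primrec_stringsOfLength : Primrec stringsOfLength :=
  Primrec.nat_rec₁ (f := fun _ (L : List BitString) =>
      L.map (List.cons true) ++ L.map (List.cons false)) [[]]
    (Primrec.list_append.comp
      (Primrec.list_map Primrec.snd (Primrec.list_cons.comp (Primrec.const true) Primrec.snd).to₂)
      (Primrec.list_map Primrec.snd
        (Primrec.list_cons.comp (Primrec.const false) Primrec.snd).to₂)).to₂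

theorem stringsOfLength_succ (n : ℕ) : stringsOfLength (n + 1) =
    (stringsOfLength n).map (List.cons true) ++ (stringsOfLength n).map (List.cons false) := rfl

theorem mem_stringsOfLength {n : ℕ} {s : BitString} : s ∈ stringsOfLength n ↔ s.length = n := by
  induction n generalizing s with
  | zero => simp [stringsOfLength]
  | succ n ih =>
    rw [stringsOfLength_succ]
    cases s with
    | nil => simp
    | cons b t => cases b <;> simp [ih]

theorem nodup_stringsOfLength (n : ℕ) : (stringsOfLength n).Nodup := by
  induction n with
  | zero => simp [stringsOfLength]
  | succ n ih =>
    rw [stringsOfLength_succ, List.nodup_append']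
    refine ⟨ih.map List.cons_injective, ih.map List.cons_injective, ?_⟩
    intro s h1 h2
    simp only [List.mem_map] at h1 h2
    obtain ⟨_, _, rfl⟩ := h1
    obtain ⟨_, _, h⟩ := h2
    simp at h

theorem length_stringsOfLength (n : ℕ) : (stringsOfLength n).length = 2 ^ n := by
  induction n with
  | zero => rfl
  | succ n ih => rw [stringsOfLength_succ]; simp [ih, pow_succ]; ring

/-! ### Searching and filtering with partial functions -/

/-- Dovetailed search for an argument at which a partial recursive function halts. -/
theorem Partrec.exists_search {α β : Type} [Primcodable α] [Primcodable β] {f : α → ℕ →. β}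
    (hf : Partrec₂ f) :
    ∃ g : α →. β, Partrec g ∧ (∀ a b, b ∈ g a → ∃ i, b ∈ f a i) ∧
      ∀ a i, (f a i).Dom → (g a).Dom := by
  obtain ⟨c, hc⟩ := Nat.Partrec.Code.exists_code.1 hf
  have key : ∀ a i m, m ∈ c.eval (Encodable.encode (a, i)) ↔ ∃ b ∈ f a i, Encodable.encode b = m := by
    intro a i m
    rw [hc]
    simp
  -- The search index `k` codes a pair: a step bound and a candidate argument.
  let s : α → ℕ → Option β := fun a k =>
    (Nat.Partrec.Code.evaln k.unpair.1 c (Encodable.encode (a, k.unpair.2))).bind Encodable.decode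
  have hs : Computable₂ s := by
    refine (Primrec.option_bind (f := fun p : α × ℕ =>
        Nat.Partrec.Code.evaln p.2.unpair.1 c (Encodable.encode (p.1, p.2.unpair.2)))
      (g := fun _ m => (Encodable.decode m : Option β)) ?_
      (Primrec.decode.comp Primrec.snd).to₂).to_comp
    have hu : Primrec fun p : α × ℕ => p.2.unpair := Primrec.unpair.comp Primrec.snd
    exact Nat.Partrec.Code.primrec_evaln.comp
      (((Primrec.fst.comp hu).pair (Primrec.const c)).pair
        (Primrec.encode.comp (Primrec.fst.pair (Primrec.snd.comp hu))))
  refine ⟨fun a => Nat.rfindOpt (s a), Partrec.rfindOpt hs, ?_, ?_⟩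
  · intro a b hb
    obtain ⟨k, hk⟩ := Nat.rfindOpt_spec hb
    obtain ⟨m, hm, hd⟩ := Option.bind_eq_some_iff.1 hk
    obtain ⟨b', hb', rfl⟩ := (key _ _ _).1 (Nat.Partrec.Code.evaln_sound hm)
    rw [Encodable.encodek, Option.some_inj] at hd
    exact ⟨_, hd ▸ hb'⟩
  · intro a i h
    have hm := (key a i _).2 ⟨_, Part.get_mem h, rfl⟩
    obtain ⟨k, hk⟩ := Nat.Partrec.Code.evaln_complete.1 hm
    refine Nat.rfindOpt_dom.2 ⟨Nat.pair k i, (f a i).get h, ?_⟩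
    refine Option.bind_eq_some_iff.2 ⟨_, ?_, Encodable.encodek _⟩
    simpa using hk

/-- The elements among the first `i` entries of `L` at which `f` has the value `[true]`. -/
def partialFilter (f : BitString →. BitString) (L : List BitString) (i : ℕ) :
    Part (List BitString) :=
  Nat.rec (Part.some []) (fun i IH => IH.bind fun acc => (f (L.getD i [])).map fun b =>
    if b = [true] then acc ++ [L.getD i []] else acc) i

theorem Partrec.partialFilter {α : Type} [Primcodable α] {f : α → BitString →. BitString}
    {L : α → List BitString} (hf : Partrec₂ f) (hL : Computable L) :
    Partrec fun a => partialFilter (f a) (L a) (L a).length := by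
  have hd : Computable fun q : α × ℕ × List BitString => (L q.1).getD q.2.1 [] :=
    (Primrec.list_getD []).to_comp.comp (hL.comp Computable.fst)
      (Computable.fst.comp Computable.snd)
  refine Partrec.nat_rec (f := fun a => (L a).length) (g := fun _ => Part.some [])
    (h := fun a q => (f a ((L a).getD q.1 [])).map fun b =>
      if b = [true] then q.2 ++ [(L a).getD q.1 []] else q.2)
    (Computable.list_length.comp hL) (Computable.const []) ?_
  refine Partrec.map (f := fun q : α × ℕ × List BitString => f q.1 ((L q.1).getD q.2.1 []))
    (g := fun q b => if b = [true] then q.2.2 ++ [(L q.1).getD q.2.1 []] else q.2.2)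
    (hf.comp Computable.fst hd) ?_
  have hi : Primrec₂ fun (q : BitString × List BitString) (b : BitString) =>
      if b = [true] then q.2 ++ [q.1] else q.2 :=
    (Primrec.ite (Primrec.eq.comp Primrec.snd (Primrec.const [true]))
      (Primrec.list_concat.comp (Primrec.snd.comp Primrec.fst) (Primrec.fst.comp Primrec.fst))
      (Primrec.snd.comp Primrec.fst)).to₂
  exact hi.to_comp.comp₂ ((hd.pair (Computable.snd.comp Computable.snd)).comp Computable.fst).to₂
    Computable.snd.to₂

theorem partialFilter_eq {f : BitString →. BitString} {good : BitString → Bool}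
    (h : ∀ x, (good x = true → [true] ∈ f x) ∧ (good x = false → [false] ∈ f x))
    (L : List BitString) {i : ℕ} (hi : i ≤ L.length) :
    partialFilter f L i = Part.some ((L.take i).filter good) := by
  induction i with
  | zero => simp [partialFilter]
  | succ i ih =>
    have hstep : partialFilter f L (i + 1) = (partialFilter f L i).bind fun acc =>
      (f (L.getD i [])).map fun b => if b = [true] then acc ++ [L.getD i []] else acc := rfl
    have hget : L.getD i [] = L[i] := List.getD_eq_getElem _ _ hi
    rw [hstep, ih (Nat.le_of_succ_le hi), hget, Part.bind_some, List.take_succ_eq_append_getElem hi,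
      List.filter_append]
    cases hg : good L[i] with
    | true => rw [Part.eq_some_iff.2 ((h _).1 hg)]; simp [hg]
    | false => rw [Part.eq_some_iff.2 ((h _).2 hg)]; simp [hg]

/-- The filter evaluates `f` at every entry it passes, whether or not that entry is kept. This lets
a computer that filters with `U p` inherit prefix-freeness from `U` at one fixed side input. -/
theorem dom_of_partialFilter_dom {f : BitString →. BitString} {L : List BitString} {i j : ℕ}
    (h : (partialFilter f L i).Dom) (hj : j < i) : (f (L.getD j [])).Dom := by
  induction i with
  | zero => omega
  | succ i ih =>
    obtain ⟨h1, h2⟩ := h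
    rcases Nat.lt_succ_iff_lt_or_eq.1 hj with hj | rfl
    · exact ih h1 hj
    · exact h2

/-! ### Programs for the universal computers -/

/-- Both `p` and `p'` are prefixes of `p' ++ s'`, hence comparable, and comparable halting programs
coincide. So a concatenation can be cut in only one way. -/
theorem IsPrefixComputer.eq_of_append_prefix {U : BitString → BitString →. BitString}
    (hU : IsPrefixComputer U) {y p p' s s' : BitString} (h : (U p y).Dom) (h' : (U p' y).Dom)
    (hs : p ++ s <+: p' ++ s') : p = p' := by
  have h1 : p <+: p' ++ s' := (List.prefix_append p s).trans hs
  rcases List.prefix_or_prefix_of_prefix h1 (List.prefix_append p' s') with h2 | h2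
  · exact hU.2 y p p' h h' h2
  · exact (hU.2 y p' p h' h h2).symm

/-- A self-delimiting program may be followed by a second one, which is run on its output. -/
theorem IsUniversalPrefixComputer.exists_concat {U : BitString → BitString →. BitString}
    (hU : IsUniversalPrefixComputer U) {f : BitString → BitString → BitString →. BitString}
    (hf : Partrec fun q : BitString × BitString × BitString => f q.1 q.2.1 q.2.2)
    (hpf : ∀ s y p q : BitString, (f s p y).Dom → (f s q y).Dom → p <+: q → p = q) :
    ∃ c : ℕ, ∀ p₁ s : BitString, s ∈ U p₁ [] → ∀ p₂ : BitString, ∃ q : BitString,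
      q.length ≤ p₁.length + p₂.length + c ∧ ∀ y b : BitString, b ∈ f s p₂ y → b ∈ U q y := by
  -- `i` is a guess for where the first program ends; the first part always runs on empty side
  -- input, and only the second one sees `y`.
  let F : BitString × BitString → ℕ →. BitString := fun a i =>
    (U (a.1.take i) []).bind fun s => f s (a.1.drop i) a.2
  have hF : Partrec₂ F := by
    have hp : Computable fun r : (BitString × BitString) × ℕ => r.1.1 :=
      Computable.fst.comp Computable.fst
    refine Partrec.bind (f := fun r : (BitString × BitString) × ℕ => U (r.1.1.take r.2) [])
      (g := fun r s => f s (r.1.1.drop r.2) r.1.2) ?_ ?_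
    · exact hU.1.1.comp (Primrec.list_take.to_comp.comp Computable.snd hp) (Computable.const [])
    · exact hf.comp (Computable.snd.pair (Computable.pair
        ((Primrec.list_drop.to_comp.comp Computable.snd hp).comp Computable.fst)
        ((Computable.snd.comp Computable.fst).comp Computable.fst)))
  obtain ⟨g, hg, hg1, hg2⟩ := Partrec.exists_search hF
  have split : ∀ p y b, b ∈ g (p, y) → ∃ p₁ p₂ s, p = p₁ ++ p₂ ∧ s ∈ U p₁ [] ∧ b ∈ f s p₂ y := by
    intro p y b hb
    obtain ⟨i, hi⟩ := hg1 _ _ hb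
    obtain ⟨s, hs, hs'⟩ := Part.mem_bind_iff.1 hi
    exact ⟨_, _, s, (List.take_append_drop i p).symm, hs, hs'⟩
  have hW : IsPrefixComputer fun p y => g (p, y) := by
    refine ⟨hg, fun y p q hp hq hpq => ?_⟩
    obtain ⟨p₁, p₂, s, rfl, hs, hb⟩ := split _ _ _ (Part.get_mem hp)
    obtain ⟨q₁, q₂, t, rfl, ht, hd⟩ := split _ _ _ (Part.get_mem hq)
    obtain rfl : p₁ = q₁ := hU.1.eq_of_append_prefix (Part.dom_iff_mem.2 ⟨_, hs⟩)
      (Part.dom_iff_mem.2 ⟨_, ht⟩) hpq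
    obtain rfl := Part.mem_unique hs ht
    rw [hpf s y p₂ q₂ (Part.dom_iff_mem.2 ⟨_, hb⟩) (Part.dom_iff_mem.2 ⟨_, hd⟩)
      ((List.prefix_append_right_inj p₁).1 hpq)]
  obtain ⟨c, hc⟩ := hU.2 _ hW
  refine ⟨c, fun p₁ s hs p₂ => ?_⟩
  obtain ⟨q, hq, hqy⟩ := hc (p₁ ++ p₂)
  refine ⟨q, by simpa using hq, fun y b hb => ?_⟩
  have hFb : b ∈ F (p₁ ++ p₂, y) p₁.length := by
    refine Part.mem_bind_iff.2 ⟨s, ?_, ?_⟩ <;> simpa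
  have hdom := hg2 _ _ (Part.dom_iff_mem.2 ⟨b, hFb⟩)
  -- The search might have stopped at another cut, but prefix-freeness forces that cut to be the
  -- intended one.
  obtain ⟨q₁, q₂, t, hpq, ht, hd⟩ := split _ _ _ (Part.get_mem hdom)
  obtain rfl : p₁ = q₁ := hU.1.eq_of_append_prefix (Part.dom_iff_mem.2 ⟨_, hs⟩)
    (Part.dom_iff_mem.2 ⟨_, ht⟩) ⟨[], by rw [List.append_nil, hpq]⟩
  obtain rfl := Part.mem_unique hs ht
  obtain rfl := List.append_cancel_left hpq
  rw [hqy, Part.mem_unique hb hd]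
  exact Part.get_mem hdom

/-- Every computable function of the side input has a program. -/
theorem IsUniversalPrefixComputer.exists_program {U : BitString → BitString →. BitString}
    (hU : IsUniversalPrefixComputer U) {f : BitString → BitString} (hf : Computable f) :
    ∃ p : BitString, ∀ y, f y ∈ U p y := by
  -- Only the empty program halts, so prefix-freeness is trivial.
  let W : BitString → BitString →. BitString := fun p y =>
    bif p.isEmpty then Part.some (f y) else Part.none
  have hW : IsPrefixComputer W := by
    constructor
    · refine Partrec.cond (c := fun q : BitString × BitString => q.1.isEmpty)
        (f := fun q => Part.some (f q.2)) (g := fun _ => Part.none) ?_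
        (hf.comp Computable.snd) Partrec.none
      refine (Primrec.beq.comp (Primrec.fst (α := BitString) (β := BitString))
        (Primrec.const [])).to_comp.of_eq ?_
      rintro ⟨_ | _, _⟩ <;> rfl
    · intro y p q hp hq _
      cases p <;> cases q <;> simp_all [W]
  obtain ⟨c, hc⟩ := hU.2 W hW
  obtain ⟨q, -, hq⟩ := hc []
  exact ⟨q, fun y => by rw [hq y]; simp [W]⟩

/-- An `sInf` in `ℕ` is attained once the set is nonempty; a program for the constant function
provides an element. -/
theorem IsUniversalPrefixComputer.exists_prefixK {U : BitString → BitString →. BitString}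
    (hU : IsUniversalPrefixComputer U) (x : BitString) :
    ∃ p : BitString, p.length = prefixK U x ∧ x ∈ U p [] := by
  obtain ⟨p, hp⟩ := hU.exists_program (Computable.const x)
  exact Nat.sInf_mem (s := {l : ℕ | ∃ p : BitString, p.length = l ∧ x ∈ U p []})
    ⟨_, p, rfl, hp []⟩

theorem IsUniversalPrefixComputer.exists_constraintK {U : BitString → BitString →. BitString}
    (hU : IsUniversalPrefixComputer U) {𝒞 : Set Ensemble} (h𝒞 : IsDecidable 𝒞) :
    ∃ p : BitString, p.length = constraintK U 𝒞 ∧ DecidesConstraint U p 𝒞 := by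
  obtain ⟨f, hf, hfC⟩ := ComputablePred.computable_iff.1 h𝒞
  obtain ⟨p, hp⟩ := hU.exists_program (f := fun x => [f x])
    (Computable.list_cons.comp hf (Computable.const []))
  refine Nat.sInf_mem (s := {l : ℕ | ∃ p : BitString, p.length = l ∧ DecidesConstraint U p 𝒞})
    ⟨_, p, rfl, fun x => ?_⟩
  have hx : dirac x ∈ 𝒞 ↔ f x = true := iff_of_eq (congrFun hfC x)
  have hpx := hp x
  refine ⟨fun h => ?_, fun h => ?_⟩
  · rwa [hx.1 h] at hpx
  · rwa [Bool.eq_false_iff.2 (mt hx.2 h)] at hpx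

/-- Simulating the identity computer gives both the bound and the existence of a program. -/
theorem IsUniversalComputer.exists_plainK_le {V : BitString →. BitString}
    (hV : IsUniversalComputer V) :
    ∃ c : ℕ, ∀ x : BitString, plainK V x ≤ x.length + c ∧
      ∃ p : BitString, p.length = plainK V x ∧ x ∈ V p := by
  obtain ⟨c, hc⟩ := hV.2 (fun p => Part.some p) Computable.id
  refine ⟨c, fun x => ?_⟩
  obtain ⟨q, hq, hqx⟩ := hc x
  have hmem : q.length ∈ {l : ℕ | ∃ p : BitString, p.length = l ∧ x ∈ V p} :=
    ⟨q, rfl, by rw [hqx]; exact Part.mem_some x⟩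
  exact ⟨(Nat.sInf_le hmem).trans hq, Nat.sInf_mem ⟨_, hmem⟩⟩

/-- `K(x) ≤ C(x) + K(C(x)) + O(1)`. -/
theorem prefixK_le_plainK_add {U : BitString → BitString →. BitString} {V : BitString →. BitString}
    (hU : IsUniversalPrefixComputer U) (hV : IsUniversalComputer V) :
    ∃ c : ℕ, ∀ x : BitString,
      prefixK U x ≤ plainK V x + prefixKNat U (plainK V x) + c := by
  -- A program for `V` becomes self-delimiting once its length is known: for fixed `s` all halting
  -- programs have the length coded by `s`.
  let f : BitString → BitString → BitString →. BitString := fun s p _ =>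
    bif p.length == Computability.decodeNat s then V p else Part.none
  have hf : Partrec fun q : BitString × BitString × BitString => f q.1 q.2.1 q.2.2 := by
    refine Partrec.cond
      (c := fun q : BitString × BitString × BitString =>
        q.2.1.length == Computability.decodeNat q.1)
      (f := fun q => V q.2.1) (g := fun _ => Part.none) ?_
      (hV.1.comp (Computable.fst.comp Computable.snd)) Partrec.none
    exact (Primrec.beq.comp (Primrec.list_length.comp (Primrec.fst.comp Primrec.snd))
      (primrec_decodeNat.comp Primrec.fst)).to_comp
  have hlen : ∀ s y p, (f s p y).Dom → p.length = Computability.decodeNat s := by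
    intro s y p h
    by_contra hne
    simp [f, beq_false_of_ne hne] at h
  obtain ⟨c, hc⟩ := hU.exists_concat hf fun s y p q hp hq hpq =>
    hpq.eq_of_length ((hlen s y p hp).trans (hlen s y q hq).symm)
  obtain ⟨_, hV'⟩ := hV.exists_plainK_le
  refine ⟨c, fun x => ?_⟩
  obtain ⟨p₁, hp₁, hs⟩ := hU.exists_prefixK (code (plainK V x))
  obtain ⟨p₂, hp₂, hx⟩ := (hV' x).2
  obtain ⟨q, hq, hqy⟩ := hc p₁ _ hs p₂
  have hb : x ∈ f (code (plainK V x)) p₂ [] := by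
    have : p₂.length = Computability.decodeNat (code (plainK V x)) := by simp [code, hp₂]
    simpa [f, this] using hx
  have hmem : q.length ∈ {l : ℕ | ∃ p : BitString, p.length = l ∧ x ∈ U p []} :=
    ⟨q, rfl, hqy [] x hb⟩
  have := Nat.sInf_le hmem
  rw [prefixK, prefixKNat]
  omega

/-- The length of an `r`-incompressible string is nearly as simple as its plain complexity. -/
theorem prefixKNat_length_le {U : BitString → BitString →. BitString} {V : BitString →. BitString}
    (hU : IsUniversalPrefixComputer U) (hV : IsUniversalComputer V) :
    ∃ c : ℕ, ∀ (r : ℕ) (x : BitString), IsIncompressible U r x →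
      prefixKNat U x.length ≤ prefixKNat U (plainK V x) + r + c := by
  obtain ⟨c, hc⟩ := prefixK_le_plainK_add hU hV
  obtain ⟨d, hd⟩ := hV.exists_plainK_le
  refine ⟨c + d, fun r x hx => ?_⟩
  have h1 := hc x
  have h2 := (hd x).1
  unfold IsIncompressible at hx
  omega

/-! ### Uniform ensembles -/

/-- Rounding `2^m / N` down costs less than `1`, that is, less than `2^(-m)` after rescaling. -/
theorem approximates_inv {N : ℕ} (hN : 0 < N) (m : ℕ) :
    Approximates (2 ^ m / N) m (N : ℝ)⁻¹ := by
  have hN' : (0 : ℝ) < N := Nat.cast_pos.2 hN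
  have h2 : (0 : ℝ) < 2 ^ m := by positivity
  have h1 : ((2 ^ m / N : ℕ) : ℝ) ≤ 2 ^ m / N := by
    simpa using Nat.cast_div_le (α := ℝ) (m := 2 ^ m) (n := N)
  have h3 : (2 : ℝ) ^ m / N < ((2 ^ m / N : ℕ) : ℝ) + 1 := by
    rw [div_lt_iff₀ hN', mul_comm]
    exact_mod_cast Nat.lt_mul_div_succ (2 ^ m) hN
  have h4 : (N : ℝ)⁻¹ - ((2 ^ m / N : ℕ) : ℝ) / 2 ^ m =
      (2 ^ m / N - ((2 ^ m / N : ℕ) : ℝ)) / 2 ^ m := by field_simp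
  rw [Approximates, h4, abs_div, abs_of_pos h2]
  gcongr
  rw [abs_le]
  constructor <;> linarith

/-- Since `2^m * log₂ N = log₂ (N^(2^m))`, the integer logarithm of `N^(2^m)` is the floor of the
rescaled value. Entropies of uniform distributions thus need only integer arithmetic. -/
theorem approximates_logb {N : ℕ} (hN : 0 < N) (m : ℕ) :
    Approximates (Nat.log 2 (N ^ 2 ^ m)) m (Real.logb 2 N) := by
  have h2 : (0 : ℝ) < 2 ^ m := by positivity
  have hM : N ^ 2 ^ m ≠ 0 := by positivity
  set l := Nat.log 2 (N ^ 2 ^ m) with hl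
  have hlog : 2 ^ m * Real.logb 2 N = Real.logb 2 ((N ^ 2 ^ m : ℕ) : ℝ) := by
    push_cast
    rw [Real.logb_pow]
    push_cast
    rfl
  have hMpos : (0 : ℝ) < ((N ^ 2 ^ m : ℕ) : ℝ) := by positivity
  have h1 : (l : ℝ) ≤ 2 ^ m * Real.logb 2 N := by
    rw [hlog, Real.le_logb_iff_rpow_le one_lt_two hMpos, Real.rpow_natCast]
    exact_mod_cast Nat.pow_log_le_self 2 hM
  have h3 : 2 ^ m * Real.logb 2 N < (l : ℝ) + 1 := by
    rw [hlog, Real.logb_lt_iff_lt_rpow one_lt_two hMpos, ← Nat.cast_succ, Real.rpow_natCast]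
    exact_mod_cast Nat.lt_pow_succ_log_self one_lt_two _
  have h4 : Real.logb 2 N - (l : ℝ) / 2 ^ m = (2 ^ m * Real.logb 2 N - l) / 2 ^ m := by
    field_simp
  rw [Approximates, h4, abs_div, abs_of_pos h2]
  gcongr
  rw [abs_le]
  constructor <;> linarith

theorem uniformOfFinset_toReal (A : Finset BitString) (hA : A.Nonempty) (s : BitString) :
    (PMF.uniformOfFinset A hA s).toReal = if s ∈ A then (A.card : ℝ)⁻¹ else 0 := by
  rw [PMF.uniformOfFinset_apply]
  split_ifs <;> simp

theorem entropyTerm_uniformOfFinset (A : Finset BitString) (hA : A.Nonempty) (s : BitString) :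
    entropyTerm (PMF.uniformOfFinset A hA) s =
      if s ∈ A then (A.card : ℝ)⁻¹ * Real.logb 2 A.card else 0 := by
  rw [entropyTerm, uniformOfFinset_toReal]
  split_ifs <;> simp

theorem entropyOf_uniformOfFinset (A : Finset BitString) (hA : A.Nonempty) :
    entropyOf (PMF.uniformOfFinset A hA) = Real.logb 2 A.card := by
  have hN : (A.card : ℝ) ≠ 0 := Nat.cast_ne_zero.2 hA.card_pos.ne'
  rw [entropyOf, tsum_eq_sum (s := A) fun s hs => by rw [entropyTerm_uniformOfFinset, if_neg hs],
    Finset.sum_congr rfl fun s hs => by rw [entropyTerm_uniformOfFinset, if_pos hs],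
    Finset.sum_const, nsmul_eq_mul, mul_inv_cancel_left₀ hN]

/-- The approximations of the probabilities and of the entropy of the uniform distribution on the
entries of `L`. -/
def uniformApprox (L : List BitString) (q : Option BitString × ℕ) : ℕ :=
  Option.casesOn q.1 (Nat.log 2 (L.length ^ 2 ^ q.2))
    fun s => if s ∈ L then 2 ^ q.2 / L.length else 0

theorem primrec₂_uniformApprox : Primrec₂ uniformApprox := by
  have hlen : Primrec fun a : List BitString × Option BitString × ℕ => a.1.length :=
    Primrec.list_length.comp Primrec.fst
  have hpow : Primrec fun a : List BitString × Option BitString × ℕ => 2 ^ a.2.2 :=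
    primrec₂_pow.comp (Primrec.const 2) (Primrec.snd.comp Primrec.snd)
  have hmem : PrimrecRel fun (L : List BitString) s => s ∈ L :=
    (PrimrecRel.exists_mem_list Primrec.eq).of_eq fun L s => by simp
  exact Primrec.option_casesOn (o := fun a : List BitString × Option BitString × ℕ => a.2.1)
    (f := fun a => Nat.log 2 (a.1.length ^ 2 ^ a.2.2))
    (g := fun a s => if s ∈ a.1 then 2 ^ a.2.2 / a.1.length else 0)
    (Primrec.fst.comp Primrec.snd) (primrec_log_two.comp (primrec₂_pow.comp hlen hpow))
    (Primrec.ite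
      (hmem.comp (Primrec.fst.comp Primrec.fst) Primrec.snd)
      (Primrec.nat_div.comp (hpow.comp Primrec.fst) (hlen.comp Primrec.fst))
      (Primrec.const 0)).to₂

theorem approximates_uniformApprox_some {L : List BitString} (hL : L.Nodup)
    (hA : L.toFinset.Nonempty) (s : BitString) (m : ℕ) :
    Approximates (uniformApprox L (some s, m)) m
      (PMF.uniformOfFinset L.toFinset hA s).toReal := by
  have hN : 0 < L.length := List.toFinset_card_of_nodup hL ▸ hA.card_pos
  rw [uniformOfFinset_toReal, List.toFinset_card_of_nodup hL]
  by_cases hs : s ∈ L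
  · simpa [uniformApprox, hs] using approximates_inv hN m
  · simp [uniformApprox, hs, Approximates]

theorem approximates_uniformApprox_none {L : List BitString} (hL : L.Nodup)
    (hA : L.toFinset.Nonempty) (m : ℕ) :
    Approximates (uniformApprox L (none, m)) m
      (entropyOf (PMF.uniformOfFinset L.toFinset hA)) := by
  have hN : 0 < L.length := List.toFinset_card_of_nodup hL ▸ hA.card_pos
  rw [entropyOf_uniformOfFinset, List.toFinset_card_of_nodup hL]
  exact approximates_logb hN m

/-- The uniform distribution on the entries of `L`. -/
def uniformEnsemble (L : List BitString) (hL : L.Nodup) (hA : L.toFinset.Nonempty) :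
    Ensemble where
  dist := PMF.uniformOfFinset L.toFinset hA
  computable_dist :=
    ⟨fun s n => uniformApprox L (some s, n),
      (primrec₂_uniformApprox.comp (Primrec.const L)
        ((Primrec.option_some.comp Primrec.fst).pair Primrec.snd)).to_comp,
      approximates_uniformApprox_some hL hA⟩
  finite_entropy := by
    refine summable_of_ne_finset_zero (s := L.toFinset) fun s hs => ?_
    rw [entropyTerm_uniformOfFinset, if_neg hs]
  computable_entropy :=
    ⟨fun n => uniformApprox L (none, n),
      (primrec₂_uniformApprox.comp (Primrec.const L)
        ((Primrec.const none).pair Primrec.id)).to_comp,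
      approximates_uniformApprox_none hL hA⟩

section uniformEnsemble

variable {L : List BitString} (hL : L.Nodup) (hA : L.toFinset.Nonempty)

theorem uniformEnsemble_prob (s : BitString) :
    (uniformEnsemble L hL hA).prob s = if s ∈ L then (L.length : ℝ)⁻¹ else 0 := by
  rw [Ensemble.prob, uniformEnsemble, uniformOfFinset_toReal, List.toFinset_card_of_nodup hL]
  simp

theorem uniformEnsemble_entropy :
    (uniformEnsemble L hL hA).entropy = Real.logb 2 L.length := by
  rw [Ensemble.entropy, uniformEnsemble, entropyOf_uniformOfFinset, List.toFinset_card_of_nodup hL]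

/-- Equality holds at `δ = 0`, and a larger `δ` only lowers the threshold because the entropy is
nonnegative. -/
theorem isTypical_uniformEnsemble {x : BitString} (hx : x ∈ L) {δ : ℝ} (hδ : 0 ≤ δ) :
    IsTypical δ x (uniformEnsemble L hL hA) := by
  have hN : (1 : ℝ) ≤ L.length := Nat.one_le_cast.2 (List.length_pos_of_mem hx)
  have hlog := Real.logb_nonneg one_lt_two hN
  rw [IsTypical, uniformEnsemble_entropy, uniformEnsemble_prob, if_pos hx]
  calc (2 : ℝ) ^ (-(Real.logb 2 L.length * (1 + δ))) ≤ 2 ^ (-Real.logb 2 L.length) :=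
        Real.rpow_le_rpow_of_exponent_le one_le_two (by nlinarith)
    _ = (L.length : ℝ)⁻¹ := by
        rw [Real.rpow_neg zero_le_two, Real.rpow_logb two_pos (by norm_num) (by linarith)]

end uniformEnsemble

theorem dirac_prob (x s : BitString) : (dirac x).prob s = if s = x then 1 else 0 := by
  rw [Ensemble.prob, dirac, PMF.pure_apply]
  split_ifs <;> simp

/-- All fields other than `dist` are propositions, and probabilities are finite, so `toReal` loses
nothing. -/
theorem Ensemble.ext_prob {E F : Ensemble} (h : ∀ s, E.prob s = F.prob s) : E = F := by
  have hd : E.dist = F.dist := by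
    ext s
    exact (ENNReal.toReal_eq_toReal_iff' (E.dist.apply_ne_top s) (F.dist.apply_ne_top s)).1 (h s)
  cases E
  cases F
  cases hd
  rfl

theorem IsConvex.uniformEnsemble_mem {𝒞 : Set Ensemble} (h𝒞 : IsConvex 𝒞) {L : List BitString}
    (hL : L.Nodup) (hA : L.toFinset.Nonempty) (hmem : ∀ y ∈ L, dirac y ∈ 𝒞) :
    uniformEnsemble L hL hA ∈ 𝒞 := by
  have hN : 0 < L.length := List.toFinset_card_of_nodup hL ▸ hA.card_pos
  -- A one-element list is separate: its only weight would be `1`, which the open interval in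
  -- `IsConvex` excludes.
  rcases Nat.eq_or_lt_of_le hN with h1 | h1
  · obtain ⟨y, rfl⟩ := List.length_eq_one_iff.1 h1.symm
    have heq : uniformEnsemble [y] hL hA = dirac y := Ensemble.ext_prob fun s => by
      rw [uniformEnsemble_prob, dirac_prob]
      simp
    exact heq ▸ hmem y (List.mem_singleton_self y)
  · have h1' : (1 : ℝ) < L.length := Nat.one_lt_cast.2 h1
    refine h𝒞 L.length (fun i => dirac L[i]) (fun _ => (L.length : ℝ)⁻¹)
      (fun i => hmem _ (List.getElem_mem _)) (fun _ => ⟨by positivity, inv_lt_one_of_one_lt₀ h1'⟩)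
      (fun _ => ⟨fun n => 2 ^ n / L.length, ?_, approximates_inv hN⟩) ?_ _ fun s => ?_
    · exact (Primrec.nat_div.comp (primrec₂_pow.comp (Primrec.const 2) Primrec.id)
        (Primrec.const _)).to_comp
    · simp [hN.ne']
    · rw [uniformEnsemble_prob, ← Finset.mul_sum]
      simp only [dirac_prob]
      by_cases hs : s ∈ L
      · obtain ⟨i, hi, rfl⟩ := List.mem_iff_getElem.1 hs
        rw [if_pos hs, Finset.sum_eq_single (⟨i, hi⟩ : Fin L.length)]
        · simp
        · intro j _ hj
          refine if_neg fun h => hj (Fin.ext ?_)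
          exact ((hL.getElem_inj_iff).1 h).symm
        · simp
      · rw [if_neg hs, Finset.sum_eq_zero, mul_zero]
        intro j _
        refine if_neg ?_
        rintro rfl
        exact hs (List.getElem_mem _)

/-! ### The uniform ensemble on the admissible strings of a given length -/

/-- A program for `n` followed by one for the constraint yields the uniform ensemble on the
admissible strings of length `n`. -/
theorem exists_ensembleK_uniform_le {U : BitString → BitString →. BitString}
    (hU : IsUniversalPrefixComputer U) :
    ∃ c : ℕ, ∀ 𝒞 : Set Ensemble, IsDecidable 𝒞 → ∀ x : BitString, dirac x ∈ 𝒞 →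
      ∃ (L : List BitString) (hL : L.Nodup) (hA : L.toFinset.Nonempty),
        x ∈ L ∧ (∀ y ∈ L, dirac y ∈ 𝒞) ∧ L.length ≤ 2 ^ x.length ∧
        ensembleK U (uniformEnsemble L hL hA) ≤
          prefixKNat U x.length + constraintK U 𝒞 + c := by
  let S : BitString → List BitString := fun s => stringsOfLength (Computability.decodeNat s)
  -- The decision program `p` is queried on the candidate strings; `y` only selects which
  -- approximation is output. The default `0` serves side inputs that code no request.
  let f : BitString → BitString → BitString →. BitString := fun s p y =>
    (partialFilter (U p) (S s) (S s).length).map fun L =>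
      code (((uncode (Option BitString × ℕ) y).map (uniformApprox L)).getD 0)
  have hf : Partrec fun q : BitString × BitString × BitString => f q.1 q.2.1 q.2.2 := by
    refine Partrec.map
      (f := fun q : BitString × BitString × BitString =>
        partialFilter (U q.2.1) (S q.1) (S q.1).length)
      (g := fun q L => code (((uncode (Option BitString × ℕ) q.2.2).map (uniformApprox L)).getD 0))
      ?_ ?_
    · refine Partrec.partialFilter (f := fun q : BitString × BitString × BitString => U q.2.1)
        ?_ ?_
      · exact hU.1.1.comp (Computable.fst.comp (Computable.snd.comp Computable.fst)) Computable.snd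
      · exact ((primrec_stringsOfLength.comp primrec_decodeNat).comp Primrec.fst).to_comp
    · refine Primrec.to_comp (primrec_code.comp (Primrec.option_getD.comp (Primrec.option_map
        ((primrec_uncode _).comp (Primrec.snd.comp (Primrec.snd.comp Primrec.fst)))
        (primrec₂_uniformApprox.comp (Primrec.snd.comp Primrec.fst) Primrec.snd).to₂)
        (Primrec.const 0)))
  -- There are `2^n ≥ 1` strings of length `n`, so entry `0` exists even for `n = 0`. It depends on
  -- `s` alone, so all halting `p` halt under `U` on a common side input.
  have hdom : ∀ s p y, (f s p y).Dom → (U p ((S s).getD 0 [])).Dom := fun s p y h =>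
    dom_of_partialFilter_dom (i := (S s).length) h (by simp [S, length_stringsOfLength])
  obtain ⟨c, hc⟩ := hU.exists_concat hf fun s y p q hp hq hpq =>
    hU.1.2 _ p q (hdom s p y hp) (hdom s q y hq) hpq
  refine ⟨c, fun 𝒞 h𝒞 x hx => ?_⟩
  classical
  obtain ⟨p₁, hp₁, hs⟩ := hU.exists_prefixK (code x.length)
  obtain ⟨p₂, hp₂, hdec⟩ := hU.exists_constraintK h𝒞
  obtain ⟨q, hq, hqy⟩ := hc p₁ _ hs p₂
  set L := (stringsOfLength x.length).filter fun y => decide (dirac y ∈ 𝒞) with hLdef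
  have hL : L.Nodup := (nodup_stringsOfLength _).filter _
  have hxL : x ∈ L := by simp [hLdef, mem_stringsOfLength, hx]
  have hA : L.toFinset.Nonempty := ⟨x, List.mem_toFinset.2 hxL⟩
  have hout : ∀ a : Option BitString × ℕ, code (uniformApprox L a) ∈ U q (code a) := by
    intro a
    refine hqy _ _ ?_
    have hS : S (code x.length) = stringsOfLength x.length := by simp [S, code]
    have := partialFilter_eq (f := U p₂) (good := fun y => decide (dirac y ∈ 𝒞))
      (fun y => by simpa using hdec y) (stringsOfLength x.length) le_rfl
    rw [List.take_length] at this
    simp only [f, hS, this, Part.map_some, uncode_code, Option.map_some, Option.getD_some]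
    exact Part.mem_some _
  refine ⟨L, hL, hA, hxL, fun y hy => by simpa using (List.mem_filter.1 hy).2, ?_, ?_⟩
  · exact (List.length_filter_le _ _).trans_eq (length_stringsOfLength _)
  · have hmem : q.length ∈ {l : ℕ | ∃ p : BitString, p.length = l ∧
        ComputesEnsemble U p (uniformEnsemble L hL hA)} :=
      ⟨q, rfl, fun s n => ⟨_, hout _, approximates_uniformApprox_some hL hA s n⟩,
        fun n => ⟨_, hout _, approximates_uniformApprox_none hL hA n⟩⟩
    have := Nat.sInf_le hmem
    rw [ensembleK, prefixKNat]
    omega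

/-- The uniform ensemble is the witness. The constant `c` of its program length enters both bounds;
`d`, from the passage from `K(ℓ(x))` to `K(C(x))`, enters only the second. -/
theorem exists_effComplexityWithin_le {U : BitString → BitString →. BitString}
    {V : BitString →. BitString} (hU : IsUniversalPrefixComputer U) (hV : IsUniversalComputer V) :
    ∃ c k : ℕ, ∀ 𝒞 : Set Ensemble, IsConvex 𝒞 → IsDecidable 𝒞 →
      ∀ (r : ℕ) (x : BitString) (δ Δ : ℝ), IsIncompressible U r x → dirac x ∈ 𝒞 → 0 ≤ δ →
        (r : ℝ) + c + constraintK U 𝒞 ≤ Δ →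
        effComplexityWithin U δ Δ x 𝒞 ≤
          ((prefixKNat U (plainK V x) + r + constraintK U 𝒞 + k : ℕ) : ℕ∞) := by
  obtain ⟨c, hc⟩ := exists_ensembleK_uniform_le hU
  obtain ⟨d, hd⟩ := prefixKNat_length_le hU hV
  refine ⟨c, c + d, fun 𝒞 hconv hdec r x δ Δ hx hx𝒞 hδ hΔ => ?_⟩
  obtain ⟨L, hL, hA, hxL, hL𝒞, hcard, hK⟩ := hc 𝒞 hdec x hx𝒞
  have hmem : uniformEnsemble L hL hA ∈ minDomain U δ Δ x ∩ 𝒞 := by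
    refine ⟨⟨isTypical_uniformEnsemble hL hA hxL hδ, ?_⟩, hconv.uniformEnsemble_mem hL hA hL𝒞⟩
    have hlog : Real.logb 2 L.length ≤ x.length := by
      rw [Real.logb_le_iff_le_rpow one_lt_two (Nat.cast_pos.2 (List.length_pos_of_mem hxL)),
        Real.rpow_natCast]
      exact_mod_cast hcard
    have hK' : (ensembleK U (uniformEnsemble L hL hA) : ℝ) ≤
        prefixKNat U x.length + constraintK U 𝒞 + c := by exact_mod_cast hK
    have hx' : (x.length : ℝ) + prefixKNat U x.length ≤ prefixK U x + r := by exact_mod_cast hx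
    rw [totalInformation, uniformEnsemble_entropy]
    linarith
  refine (iInf₂_le _ hmem).trans (Nat.cast_le.2 ?_)
  have := hd r x hx
  omega

end EffectiveComplexity

end

theorem corollary7
    (U : EffectiveComplexity.BitString →
      EffectiveComplexity.BitString →. EffectiveComplexity.BitString)
    (V : EffectiveComplexity.BitString →. EffectiveComplexity.BitString)
    (hU : EffectiveComplexity.IsUniversalPrefixComputer U)
    (hV : EffectiveComplexity.IsUniversalComputer V) :
    ∃ c k : ℕ,
      (∀ (r : ℕ) (x : EffectiveComplexity.BitString) (δ Δ : ℝ),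
        EffectiveComplexity.IsIncompressible U r x → 0 ≤ δ → (r : ℝ) + c ≤ Δ →
        EffectiveComplexity.effComplexity U δ Δ x ≤
          ((EffectiveComplexity.prefixKNat U (EffectiveComplexity.plainK V x) + r + k : ℕ) :
            ℕ∞)) ∧
      (∀ 𝒞 : Set EffectiveComplexity.Ensemble,
        EffectiveComplexity.IsConvex 𝒞 → EffectiveComplexity.IsDecidable 𝒞 →
        ∀ (r : ℕ) (x : EffectiveComplexity.BitString) (δ Δ : ℝ),
          EffectiveComplexity.IsIncompressible U r x → EffectiveComplexity.dirac x ∈ 𝒞 →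
          0 ≤ δ → (r : ℝ) + c + EffectiveComplexity.constraintK U 𝒞 ≤ Δ →
          EffectiveComplexity.effComplexityWithin U δ Δ x 𝒞 ≤
            ((EffectiveComplexity.prefixKNat U (EffectiveComplexity.plainK V x) + r +
              EffectiveComplexity.constraintK U 𝒞 + k : ℕ) : ℕ∞)) := by
  obtain ⟨c, k, h⟩ := EffectiveComplexity.exists_effComplexityWithin_le hU hV
  have hconv : EffectiveComplexity.IsConvex Set.univ := fun _ _ _ _ _ _ _ _ _ => trivial
  have hdec : EffectiveComplexity.IsDecidable Set.univ :=
    ComputablePred.computable_iff.2 ⟨fun _ => true, Computable.const true, by simp⟩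
  set u := EffectiveComplexity.constraintK U Set.univ with hu
  -- The complexity `u` of the trivial constraint depends only on `U`; it is absorbed into both
  -- constants, which does no harm to the constrained claim.
  refine ⟨c + u, k + u, fun r x δ Δ hx hδ hΔ => ?_, fun 𝒞 h1 h2 r x δ Δ hx hx𝒞 hδ hΔ => ?_⟩
  · have := h Set.univ hconv hdec r x δ Δ hx trivial hδ (by push_cast at hΔ; linarith)
    rw [EffectiveComplexity.effComplexityWithin, Set.inter_univ] at this
    exact this.trans (Nat.cast_le.2 (by omega))
  · have hu0 : (0 : ℝ) ≤ u := Nat.cast_nonneg u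
    exact (h 𝒞 h1 h2 r x δ Δ hx hx𝒞 hδ (by push_cast at hΔ; linarith)).trans
      (Nat.cast_le.2 (by omega))
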